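/- Let $A\subset\mathbb R^2$ be a measurable field of finite area. IoT devices are scattered on $A$ as a homogeneous Poisson point process of density $\lambda$. In a time slot each device transmits independently with probability $a$ (slotted ALOHA), and its power fading gain $G$ is Gamma distributed with density $m^m g^{m-1}e^{-mg}/\Gamma(m)$, $m\in\mathbb Z_{\ge1}$ (Nakagami-$m$ fading); positions, transmission decisions and gains are independent. A UAV hovers at altitude $h>0$ above the centre of a disk $A_\mu\subseteq A$ of radius $R$, and $d=\sqrt{h^2+R^2}$. Let $\tilde\Psi$ be the set of devices in $A_\mu$ that transmit; for $x\in\tilde\Psi$ let $G_x$ be its gain, $D_x$ its distance to the UAV and $$\mathrm{SINR}_x=\frac{P\,G_xD_x^{-\eta}}{\sum_{y\in\tilde\Psi\setminus\{x\}}P\,G_yD_y^{-\eta}+\sigma_n^2},$$ with path-loss exponent $\eta>0$, transmission power $P>0$ and noise variance $\sigma_n^2>0$. Let $A_{mse}$ be a disk of radius $R_{mse}>0$ centred at a point of the boundary circle of $A_\mu$, let $A_{int}=A_{mse}\cap A_\mu$, let $\beta\ge1$ be the SINR threshold, and let $P_e^s$ be the probability that some $x\in\tilde\Psi\cap A_{int}$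 has $\mathrm{SINR}_x\ge\beta$. Put $$\mathcal L_I(s)=e^{-s\sigma_n^2/P}\exp\Big(-2\pi\lambda a\int_h^d\Big(1-\big(1+\tfrac{s r^{-\eta}}{m}\big)^{-m}\Big)r\,dr\Big),$$ which for $s\ge0$ is the Laplace transform $\mathbb E[e^{-sI}]$ of the normalized interference-plus-noise power $I=\sum_{y\in\tilde\Psi}G_yD_y^{-\eta}+\sigma_n^2/P$. If $R_{mse}\le R$, then $$P_e^s=2a\lambda\int_{\sqrt{h^2+(R-R_{mse})^2}}^{d}\ \sum_{k=0}^{m-1}\frac{(-m\beta r^\eta)^k}{k!}\Big[\frac{\partial^k}{\partial s^k}\mathcal L_I(s)\Big]_{s=m\beta r^\eta}\ r\,\arccos\!\Big(\frac{R^2+r^2-h^2-R_{mse}^2}{2R\sqrt{r^2-h^2}}\Big)\,dr,$$ where the integrand is integrable. -/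

import Mathlib

open MeasureTheory ProbabilityTheory
open scoped NNReal

noncomputable section

/-- The ground plane, with the Euclidean norm and Lebesgue measure. -/
abbrev Plane := EuclideanSpace ℝ (Fin 2)

/-- A network of devices on the field `A`, observed in one time slot.  The devices form a homogeneous
Poisson point process of density `lam` on `A`: their number `N` is Poisson with mean `lam * |A|` and,
independently of `N`, their positions `X 0, X 1, …` are independent and uniform on `A`
(only the devices with index `n < N` are present).
Device `n` transmits (`T n = true`) with probability `a` and has the power fading gain `G n` of a
Nakagami-`m` channel, i.e. a Gamma variable of shape `m` and rate `m`, with density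
`m ^ m * g ^ (m - 1) / Γ(m) * exp (- m * g)`.  Positions, transmission decisions, gains and `N` are all
independent. -/
structure IsAlohaNetwork {Ω : Type*} [MeasurableSpace Ω] (μ : Measure Ω)
    (A : Set Plane) (lam : ℝ≥0) (a : unitInterval) (m : ℕ)
    (N : Ω → ℕ) (X : ℕ → Ω → Plane) (T : ℕ → Ω → Bool) (G : ℕ → Ω → ℝ) : Prop where
  law_count : HasLaw N (poissonMeasure (lam * (volume A).toNNReal)) μ
  law_node : ∀ n, HasLaw (fun ω => (X n ω, T n ω, G n ω))
    ((cond volume A).prod ((bernoulliMeasure true false a).prod (gammaMeasure m m))) μ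
  indep_nodes : iIndepFun (fun n ω => (X n ω, T n ω, G n ω)) μ
  indep_count : IndepFun N (fun ω n => (X n ω, T n ω, G n ω)) μ

/-- Distance from the ground point `x` to the UAV hovering at altitude `h` above `c`. -/
def uavDist (c : Plane) (h : ℝ) (x : Plane) : ℝ := Real.sqrt (dist x c ^ 2 + h ^ 2)

section Slot

variable {Ω : Type*} (c : Plane) (h R η Ptx σ2 : ℝ)
  (N : Ω → ℕ) (X : ℕ → Ω → Plane) (T : ℕ → Ω → Bool) (G : ℕ → Ω → ℝ) (ω : Ω)

open Classical in
/-- The (indices of the) devices inside the hovering disk of centre `c` and radius `R` that transmit. -/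
def transmitters : Finset ℕ :=
  (Finset.range (N ω)).filter (fun n => X n ω ∈ Metric.closedBall c R ∧ T n ω = true)

/-- The SINR at the UAV of the signal of device `n`; `Ptx` is the transmission power, `σ2` the noise
variance, and all other transmitters in the hovering disk interfere. -/
def sinr (n : ℕ) : ℝ :=
  Ptx * G n ω * uavDist c h (X n ω) ^ (-η) /
    (∑ j ∈ (transmitters c R N X T ω).erase n, Ptx * G j ω * uavDist c h (X j ω) ^ (-η) + σ2)

/-- The normalized interference-plus-noise power created by the transmitting devices. -/
def interference : ℝ :=
  ∑ j ∈ transmitters c R N X T ω, G j ω * uavDist c h (X j ω) ^ (-η) + σ2 / Ptx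

end Slot

/-- The event that a device located in the intersection of the hovering disk `closedBall c R` with the
disk `closedBall e Rmse` transmits successfully, i.e. with SINR at least `β`. -/
def successEvent {Ω : Type*} (c e : Plane) (h R Rmse η Ptx σ2 β : ℝ)
    (N : Ω → ℕ) (X : ℕ → Ω → Plane) (T : ℕ → Ω → Bool) (G : ℕ → Ω → ℝ) : Set Ω :=
  {ω | ∃ n ∈ transmitters c R N X T ω,
    X n ω ∈ Metric.closedBall e Rmse ∩ Metric.closedBall c R ∧
      β ≤ sinr c h R η Ptx σ2 N X T G ω n}

/-- The closed form of the Laplace transform of the normalized interference-plus-noise power;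
`d = √(h² + R²)` is the distance from the UAV to the edge of the hovering disk. -/
def laplaceI (lam a h R η Ptx σ2 : ℝ) (m : ℕ) (s : ℝ) : ℝ :=
  Real.exp (-s * σ2 / Ptx) *
    Real.exp (-2 * Real.pi * lam * a *
      ∫ r in h..Real.sqrt (h ^ 2 + R ^ 2), (1 - (1 + s * r ^ (-η) / m) ^ (-(m : ℤ))) * r)

/-- The integrand of the success probability over the UAV-to-device distance `r`, with the angular
weight `arccos`. -/
def successIntegrand (lam a h R Rmse η Ptx σ2 β : ℝ) (m : ℕ) (r : ℝ) : ℝ :=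
  (∑ k ∈ Finset.range m, (-(m * β * r ^ η)) ^ k / (k.factorial : ℝ) *
      iteratedDeriv k (laplaceI lam a h R η Ptx σ2 m) (m * β * r ^ η)) * r *
    Real.arccos ((R ^ 2 + r ^ 2 - h ^ 2 - Rmse ^ 2) / (2 * R * Real.sqrt (r ^ 2 - h ^ 2)))

end

/-! Because `β ≥ 1`, two devices cannot succeed in the same slot: each would have to be received
with strictly more power than the other. The success probability is therefore the expected number of
successful devices in the lens (`sum_successIndicator_eq_indicator`), and an expectation of a sum
over a Poisson process is accessible.

The Mecke formula (`lintegral_sum_poisson`) replaces that sum by an integral over one extra device,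
independent of a full copy of the network; so the transform of the total interference appears,
although the SINR omits the device's own signal. The mean number of points `lam * |A|` cancels the
uniform density `1 / |A|` of a position, and the transmission decision contributes the factor `a`.

For an extra device at distance `r`, success means that its gain is at least `β r^η I`. The gain is
Gamma with integer shape `m` and rate `m`, so the conditional probability is the Erlang tail
`exp(-sI) ∑_{k<m} (sI)^k / k!` with `s = mβr^η` (`gammaMeasure_Ici`). Its mean is a combination of
derivatives of the Laplace transform of `I` at `s` (`sum_iteratedDeriv_laplace`). The transform
itself comes from the Laplace functional of the process (`integral_exp_neg_sum_poisson`) and the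
Gamma transform. Polar coordinates about the disk centre, with `r² = h² + ρ²` and hence `ρ dρ = r
dr`, turn the lens into the `arccos` weight (`lintegral_lens_uavDist`). -/

open scoped ENNReal

/-! ### Poisson number of i.i.d. points: Mecke formula and Laplace functional. -/

section PoissonSum

variable {Ω E : Type*} [MeasurableSpace Ω] [MeasurableSpace E] {μ : Measure Ω} {ν : Measure E}
  {Z : ℕ → Ω → E} {N : Ω → ℕ}

/-- Sums of the same number of terms of an i.i.d. sequence have the same law. -/
theorem map_sum_eq_of_card_eq [IsProbabilityMeasure μ] (hZ : ∀ n, Measurable (Z n))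
    (hlaw : ∀ n, μ.map (Z n) = ν) (hind : iIndepFun Z μ) {g : E → ℝ} (hg : Measurable g)
    {S S' : Finset ℕ} (hS : S.card = S'.card) :
    μ.map (fun ω => ∑ j ∈ S, g (Z j ω)) = μ.map (fun ω => ∑ j ∈ S', g (Z j ω)) := by
  have hind' : iIndepFun (fun n ω => g (Z n ω)) μ := hind.comp (fun _ => g) (fun _ => hg)
  have hm : ∀ n, AEMeasurable (fun ω => g (Z n ω)) μ := fun n => (hg.comp (hZ n)).aemeasurable
  -- By independence the characteristic function of the sum is a power of a single one, so only the
  -- cardinality of `U` enters.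
  have key : ∀ U : Finset ℕ, charFun (μ.map (fun ω => ∑ j ∈ U, g (Z j ω))) =
      (charFun (ν.map g)) ^ U.card := by
    intro U
    rw [(hind'.restrict U).charFun_map_fun_finsetSum_eq_prod fun i _ => hm i]
    rw [Finset.prod_congr rfl (g := fun _ => charFun (ν.map g)), Finset.prod_const]
    intro j _
    rw [← hlaw j, Measure.map_map hg (hZ j)]
    rfl
  have : ∀ U : Finset ℕ, IsProbabilityMeasure (μ.map (fun ω => ∑ j ∈ U, g (Z j ω))) := fun U =>
    Measure.isProbabilityMeasure_map (by fun_prop)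
  apply Measure.ext_of_charFun
  rw [key, key, hS]

/-- A point is independent of any sum over other indices, so the joint law is a product. This
separates a tagged device from its interferers. -/
theorem lintegral_apply_sum_of_notMem [IsProbabilityMeasure μ] (hZ : ∀ n, Measurable (Z n))
    (hlaw : ∀ n, μ.map (Z n) = ν) (hind : iIndepFun Z μ) {g : E → ℝ} (hg : Measurable g)
    {f : E × ℝ → ℝ≥0∞} (hf : Measurable f) {n : ℕ} {S : Finset ℕ} (hn : n ∉ S) :
    ∫⁻ ω, f (Z n ω, ∑ j ∈ S, g (Z j ω)) ∂μ =
      ∫⁻ z, ∫⁻ w, f (z, w) ∂(μ.map (fun ω => ∑ j ∈ S, g (Z j ω))) ∂ν := by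
  have hsum : Measurable (fun ω => ∑ j ∈ S, g (Z j ω)) :=
    Finset.measurable_sum _ fun j _ => hg.comp (hZ j)
  have h1 : IndepFun (Z n) (fun ω => ∑ j ∈ S, g (Z j ω)) μ := by
    have h2 := hind.indepFun_finset {n} S (by simpa using hn) hZ
    have hφ : Measurable (fun v : ({n} : Finset ℕ) → E => v ⟨n, Finset.mem_singleton_self n⟩) :=
      measurable_pi_apply _
    have h3 := h2.comp (ψ := fun v : S → E => ∑ j, g (v j))
      hφ
      (Finset.measurable_sum _ fun j _ => hg.comp (measurable_pi_apply j))
    refine h3.congr (Filter.EventuallyEq.of_eq rfl) (Filter.EventuallyEq.of_eq ?_)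
    funext ω
    simp only [Function.comp]
    exact Finset.sum_coe_sort S (fun j => g (Z j ω))
  rw [indepFun_iff_map_prod_eq_prod_map_map (hZ n).aemeasurable hsum.aemeasurable] at h1
  have : IsProbabilityMeasure (μ.map (fun ω => ∑ j ∈ S, g (Z j ω))) :=
    Measure.isProbabilityMeasure_map hsum.aemeasurable
  rw [← lintegral_prod _ hf.aemeasurable, ← hlaw n, ← h1,
    lintegral_map hf ((hZ n).prodMk hsum)]

/-- Conditioning on the value of an independent discrete variable. -/
theorem lintegral_apply_eq_tsum [IsProbabilityMeasure μ] (hZ : ∀ n, Measurable (Z n))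
    (hN : Measurable N) (hNZ : IndepFun N (fun ω n => Z n ω) μ)
    {F : ℕ → (ℕ → E) → ℝ≥0∞} (hF : ∀ k, Measurable (F k)) :
    ∫⁻ ω, F (N ω) (fun n => Z n ω) ∂μ =
      ∑' k, μ.map N {k} * ∫⁻ ω, F k (fun n => Z n ω) ∂μ := by
  have hZ' : Measurable (fun ω n => Z n ω) := measurable_pi_lambda _ hZ
  have h1 := (indepFun_iff_map_prod_eq_prod_map_map hN.aemeasurable hZ'.aemeasurable).1 hNZ
  have hF' : Measurable (fun p : ℕ × (ℕ → E) => F p.1 p.2) := measurable_from_prod_countable_right hF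
  have : IsProbabilityMeasure (μ.map (fun ω n => Z n ω)) :=
    Measure.isProbabilityMeasure_map hZ'.aemeasurable
  calc ∫⁻ ω, F (N ω) (fun n => Z n ω) ∂μ
      = ∫⁻ p, F p.1 p.2 ∂(μ.map (fun ω => (N ω, fun n => Z n ω))) :=
        (lintegral_map hF' (hN.prodMk hZ')).symm
    _ = ∫⁻ k, ∫⁻ z, F k z ∂(μ.map (fun ω n => Z n ω)) ∂(μ.map N) := by
        rw [h1, lintegral_prod _ hF'.aemeasurable]
    _ = _ := by
        rw [lintegral_countable']
        refine tsum_congr fun k => ?_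
        rw [mul_comm, lintegral_map (hF k) hZ']

/-- The size-biasing identity that characterises the Poisson distribution. -/
theorem tsum_poissonMeasure_mul (Λ : ℝ≥0) (q : ℕ → ℝ≥0∞) :
    ∑' k, poissonMeasure Λ {k} * (k * q (k - 1)) = Λ * ∑' k, poissonMeasure Λ {k} * q k := by
  -- The term `k = 0` carries the factor `0`, so the truncated value `0 - 1 = 0` is harmless; the
  -- rest is `(k + 1) P(k + 1) = Λ P(k)`.
  rw [tsum_eq_zero_add' ENNReal.summable, ← ENNReal.tsum_mul_left]
  simp only [Nat.cast_zero, zero_mul, mul_zero, zero_add, Nat.add_sub_cancel]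
  refine tsum_congr fun k => ?_
  rw [← mul_assoc, ← mul_assoc]
  congr 1
  rw [poissonMeasure_singleton, poissonMeasure_singleton,
    ← ENNReal.ofReal_natCast, ← ENNReal.ofReal_coe_nnreal (p := Λ),
    ← ENNReal.ofReal_mul (by positivity), ← ENNReal.ofReal_mul (by positivity)]
  congr 1
  rw [Nat.factorial_succ]
  push_cast
  field_simp
  ring

/-- The Mecke formula for a Poisson number of i.i.d. points, for functionals of a point and of
the sum of `g` over the other points. -/
theorem lintegral_sum_poisson [IsProbabilityMeasure μ] (hZ : ∀ n, Measurable (Z n))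
    (hlaw : ∀ n, μ.map (Z n) = ν) (hind : iIndepFun Z μ) (hN : Measurable N) {Λ : ℝ≥0}
    (hNlaw : μ.map N = poissonMeasure Λ) (hNZ : IndepFun N (fun ω n => Z n ω) μ)
    {g : E → ℝ} (hg : Measurable g) {f : E × ℝ → ℝ≥0∞} (hf : Measurable f) :
    ∫⁻ ω, ∑ n ∈ Finset.range (N ω), f (Z n ω, ∑ j ∈ (Finset.range (N ω)).erase n, g (Z j ω)) ∂μ =
      Λ * ∫⁻ z, ∫⁻ ω, f (z, ∑ j ∈ Finset.range (N ω), g (Z j ω)) ∂μ ∂ν := by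
  have : IsProbabilityMeasure ν := hlaw 0 ▸ Measure.isProbabilityMeasure_map (hZ 0).aemeasurable
  have hsum : ∀ S : Finset ℕ, Measurable (fun ω => ∑ j ∈ S, g (Z j ω)) := fun S =>
    Finset.measurable_sum _ fun j _ => hg.comp (hZ j)
  have hpi : ∀ S : Finset ℕ, Measurable (fun v : ℕ → E => ∑ j ∈ S, g (v j)) := fun S =>
    Finset.measurable_sum _ fun j _ => hg.comp (measurable_pi_apply j)
  rw [lintegral_apply_eq_tsum (F := fun k v => ∑ n ∈ Finset.range k,
    f (v n, ∑ j ∈ (Finset.range k).erase n, g (v j))) hZ hN hNZ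
    (fun k => Finset.measurable_sum _ fun n _ =>
      hf.comp ((measurable_pi_apply n).prodMk (hpi _)))]
  have h1 : ∀ z, ∫⁻ ω, f (z, ∑ j ∈ Finset.range (N ω), g (Z j ω)) ∂μ = ∑' k, μ.map N {k} *
      ∫⁻ ω, f (z, ∑ j ∈ Finset.range k, g (Z j ω)) ∂μ := fun z =>
    lintegral_apply_eq_tsum (F := fun k v => f (z, ∑ j ∈ Finset.range k, g (v j))) hZ hN hNZ
      (fun k => hf.comp (measurable_const.prodMk (hpi _)))
  have hmk : ∀ k, Measurable fun z => ∫⁻ ω, f (z, ∑ j ∈ Finset.range k, g (Z j ω)) ∂μ := fun k =>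
    Measurable.lintegral_prod_right' (f := fun p : E × Ω => f (p.1, ∑ j ∈ Finset.range k, g (Z j p.2)))
      (hf.comp (measurable_fst.prodMk ((hsum _).comp measurable_snd)))
  simp_rw [h1]
  rw [lintegral_tsum fun k => ((hmk k).const_mul _).aemeasurable]
  simp_rw [lintegral_const_mul _ (hmk _), hNlaw]
  -- Given `k` points, the sum consists of `k` equal terms, each involving the `k - 1` other points;
  -- size-biasing turns these back into a Poisson number.
  rw [← tsum_poissonMeasure_mul]
  refine tsum_congr fun k => ?_
  congr 1
  rw [lintegral_finsetSum (Finset.range k) (f := fun n ω => f (Z n ω, ∑ j ∈ (Finset.range k).erase n, g (Z j ω)))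
      fun n _ => hf.comp ((hZ n).prodMk (hsum _)),
    Finset.sum_congr rfl (g := fun _ => ∫⁻ z, ∫⁻ ω,
      f (z, ∑ j ∈ Finset.range (k - 1), g (Z j ω)) ∂μ ∂ν)]
  · simp
  intro n hn
  rw [lintegral_apply_sum_of_notMem hZ hlaw hind hg hf (Finset.notMem_erase n _),
    map_sum_eq_of_card_eq (S' := Finset.range (k - 1)) hZ hlaw hind hg
      (by rw [Finset.card_erase_of_mem hn]; simp)]
  refine lintegral_congr fun z => ?_
  exact lintegral_map (f := fun w => f (z, w)) (hf.comp measurable_prodMk_left) (hsum _)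

/-- The Laplace functional of a Poisson number of i.i.d. points. -/
theorem integral_exp_neg_sum_poisson [IsProbabilityMeasure μ] (hZ : ∀ n, Measurable (Z n))
    (hlaw : ∀ n, μ.map (Z n) = ν) (hind : iIndepFun Z μ) (hN : Measurable N) {Λ : ℝ≥0}
    (hNlaw : μ.map N = poissonMeasure Λ) (hNZ : IndepFun N (fun ω n => Z n ω) μ)
    {u : E → ℝ} (hu : Measurable u) {p : ℝ} (hp : 0 ≤ p)
    (hup : ∫⁻ z, ENNReal.ofReal (u z) ∂ν = ENNReal.ofReal p) :
    ∫⁻ ω, ∏ n ∈ Finset.range (N ω), ENNReal.ofReal (u (Z n ω)) ∂μ =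
      ENNReal.ofReal (Real.exp (-(Λ * (1 - p)))) := by
  have hu' : Measurable fun z => ENNReal.ofReal (u z) := hu.ennreal_ofReal
  rw [lintegral_apply_eq_tsum (F := fun k v => ∏ n ∈ Finset.range k, ENNReal.ofReal (u (v n)))
    hZ hN hNZ (fun k => Finset.measurable_prod _ fun n _ => hu'.comp (measurable_pi_apply n))]
  have hprod : ∀ k, ∫⁻ ω, ∏ n ∈ Finset.range k, ENNReal.ofReal (u (Z n ω)) ∂μ =
      ENNReal.ofReal (p ^ k) := by
    intro k
    rw [lintegral_prod_eq_prod_lintegral_of_indepFun (Finset.range k)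
      (fun n ω => ENNReal.ofReal (u (Z n ω))) (hind.comp _ fun _ => hu')
      (fun n => hu'.comp (hZ n))]
    rw [Finset.prod_congr rfl (g := fun _ => ENNReal.ofReal p), Finset.prod_const,
      Finset.card_range, ENNReal.ofReal_pow hp]
    intro n _
    rw [← hup, ← hlaw n, lintegral_map hu' (hZ n)]
  simp_rw [hprod, hNlaw, poissonMeasure_singleton]
  simp_rw [← ENNReal.ofReal_mul (show 0 ≤ Real.exp (-(Λ : ℝ)) * Λ ^ _ / (Nat.factorial _ : ℝ) by
    positivity)]
  -- Exponential series of `Λ * p`: the generating function of the Poisson law at `p`.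
  have hs : HasSum (fun k : ℕ => Real.exp (-(Λ : ℝ)) * Λ ^ k / (Nat.factorial k : ℝ) * p ^ k)
      (Real.exp (-(Λ * (1 - p)))) := by
    have := (NormedSpace.expSeries_div_hasSum_exp (𝔸 := ℝ) (Λ * p)).mul_left (Real.exp (-(Λ : ℝ)))
    rw [← Real.exp_eq_exp_ℝ, ← Real.exp_add] at this
    rw [show -(Λ * (1 - p)) = -(Λ : ℝ) + Λ * p by ring]
    refine this.congr_fun fun k => ?_
    rw [mul_pow]; ring
  rw [← ENNReal.ofReal_tsum_of_nonneg (fun k => by positivity) hs.summable, hs.tsum_eq]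

end PoissonSum

/-! ### Gamma laws of integer shape: tail and Laplace transform. -/

section GammaDistribution

/-- The tail of the Gamma distribution of shape `m` and rate `1`, evaluated at `u`. -/
noncomputable def erlangTail (m : ℕ) (u : ℝ) : ℝ :=
  Real.exp (-u) * ∑ k ∈ Finset.range m, u ^ k / (k.factorial : ℝ)

theorem erlangTail_nonneg (m : ℕ) {u : ℝ} (hu : 0 ≤ u) : 0 ≤ erlangTail m u := by
  unfold erlangTail; positivity

theorem erlangTail_le_one (m : ℕ) {u : ℝ} (hu : 0 ≤ u) : erlangTail m u ≤ 1 := by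
  have := Real.sum_le_exp_of_nonneg hu m
  calc erlangTail m u ≤ Real.exp (-u) * Real.exp u := by
        unfold erlangTail; gcongr
    _ = 1 := by rw [← Real.exp_add]; simp

@[fun_prop]
theorem continuous_erlangTail (m : ℕ) : Continuous (erlangTail m) := by
  unfold erlangTail; fun_prop

/-- The derivative telescopes: differentiating each power cancels the exponential's contribution
from the preceding term, and only the last monomial survives. -/
theorem hasDerivAt_erlangTail (n : ℕ) (u : ℝ) :
    HasDerivAt (erlangTail (n + 1)) (-(u ^ n / (n.factorial : ℝ) * Real.exp (-u))) u := by
  induction n with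
  | zero =>
    have : erlangTail (0 + 1) = fun u => Real.exp (-u) := by funext u; simp [erlangTail]
    rw [this]
    simpa using (hasDerivAt_neg u).exp
  | succ n ih =>
    have : erlangTail (n + 1 + 1) = fun u => erlangTail (n + 1) u +
        Real.exp (-u) * (u ^ (n + 1) / ((n + 1).factorial : ℝ)) := by
      funext u; simp only [erlangTail]; rw [Finset.sum_range_succ, mul_add]
    rw [this]
    have h1 := (hasDerivAt_neg u).exp.mul
      ((hasDerivAt_pow (n + 1) u).div_const ((n + 1).factorial : ℝ))
    refine (ih.add h1).congr_deriv ?_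
    rw [Nat.factorial_succ]
    push_cast
    have : (n.factorial : ℝ) ≠ 0 := by positivity
    field_simp
    ring

theorem tendsto_erlangTail (m : ℕ) :
    Filter.Tendsto (erlangTail m) Filter.atTop (nhds 0) := by
  have h : ∀ k : ℕ, Filter.Tendsto (fun u : ℝ => u ^ k * Real.exp (-u) / (k.factorial : ℝ))
      Filter.atTop (nhds 0) := fun k => by
    simpa using (Real.tendsto_pow_mul_exp_neg_atTop_nhds_zero k).div_const (k.factorial : ℝ)
  have := tendsto_finsetSum (Finset.range m) fun k _ => h k
  simp only [Finset.sum_const_zero] at this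
  refine this.congr fun u => ?_
  rw [erlangTail, Finset.mul_sum]
  exact Finset.sum_congr rfl fun k _ => by ring

/-- Tail probabilities of the Gamma distribution with integer shape. -/
theorem gammaMeasure_Ici {m : ℕ} (hm : 1 ≤ m) {b t : ℝ} (hb : 0 < b) (ht : 0 ≤ t) :
    -- The density is the derivative of minus the rescaled Erlang tail, which vanishes at infinity.
    gammaMeasure m b (Set.Ici t) = ENNReal.ofReal (erlangTail m (b * t)) := by
  obtain ⟨n, rfl⟩ : ∃ n, m = n + 1 := ⟨m - 1, by omega⟩
  have hd : ∀ x : ℝ, HasDerivAt (fun x => -erlangTail (n + 1) (b * x))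
      (b * ((b * x) ^ n / (n.factorial : ℝ) * Real.exp (-(b * x)))) x := fun x => by
    have h1 : HasDerivAt (fun x : ℝ => b * x) b x := by simpa using (hasDerivAt_id x).const_mul b
    refine ((hasDerivAt_erlangTail n (b * x)).comp x h1).neg.congr_deriv ?_
    ring
  have hlim : Filter.Tendsto (fun x => -erlangTail (n + 1) (b * x)) Filter.atTop (nhds 0) := by
    simpa using ((tendsto_erlangTail (n + 1)).comp (Filter.tendsto_id.const_mul_atTop hb)).neg
  have hpos : ∀ x ∈ Set.Ioi t, 0 ≤ b * ((b * x) ^ n / (n.factorial : ℝ) * Real.exp (-(b * x))) :=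
    fun x hx => by
      have : 0 ≤ x := ht.trans (le_of_lt hx)
      positivity
  have hint := integrableOn_Ioi_deriv_of_nonneg (hd t).continuousAt.continuousWithinAt
    (fun x _ => hd x) hpos hlim
  have hval := integral_Ioi_of_hasDerivAt_of_nonneg (hd t).continuousAt.continuousWithinAt
    (fun x _ => hd x) hpos hlim
  rw [gammaMeasure, withDensity_apply _ measurableSet_Ici, setLIntegral_congr Ioi_ae_eq_Ici.symm]
  rw [show erlangTail (n + 1) (b * t) = 0 - -erlangTail (n + 1) (b * t) by ring, ← hval,
    ofReal_integral_eq_lintegral_ofReal hint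
      ((ae_restrict_iff' measurableSet_Ioi).2 (Filter.Eventually.of_forall hpos))]
  refine setLIntegral_congr_fun measurableSet_Ioi fun x hx => ?_
  have hx0 : 0 < x := ht.trans_lt hx
  rw [gammaPDF_of_nonneg hx0.le]
  congr 1
  push_cast
  rw [Real.Gamma_nat_eq_factorial, add_sub_cancel_right, Real.rpow_natCast,
    Real.rpow_add_one hb.ne', Real.rpow_natCast]
  ring

/-- The Laplace transform of the Gamma distribution. -/
theorem lintegral_exp_neg_mul_gammaMeasure {m : ℕ} (hm : 1 ≤ m) {b u : ℝ} (hb : 0 < b)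
    (hu : 0 ≤ u) :
    ∫⁻ x, ENNReal.ofReal (Real.exp (-(u * x))) ∂(gammaMeasure m b) =
      ENNReal.ofReal ((1 + u / b) ^ (-(m : ℤ))) := by
  have hm0 : (0 : ℝ) < m := by exact_mod_cast hm
  have hmeas : ∀ r : ℝ, Measurable (gammaPDF m r) := fun r =>
    (measurable_gammaPDFReal m r).ennreal_ofReal
  rw [gammaMeasure, lintegral_withDensity_eq_lintegral_mul _ (hmeas b) (by fun_prop)]
  -- Exponential tilting: `exp(-ux)` times the density of rate `b` is a constant times the density
  -- of rate `b + u`, whose total mass is `1`.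
  rw [← mul_one (ENNReal.ofReal ((1 + u / b) ^ (-(m : ℤ)))),
    ← lintegral_gammaPDF_eq_one hm0 (show 0 < b + u by positivity),
    ← lintegral_const_mul _ (hmeas _)]
  refine lintegral_congr fun x => ?_
  simp only [Pi.mul_apply]
  rcases lt_or_ge x 0 with hx | hx
  · rw [gammaPDF_of_neg hx, gammaPDF_of_neg hx]; simp
  rw [gammaPDF_of_nonneg hx, gammaPDF_of_nonneg hx,
    ← ENNReal.ofReal_mul (by have := Real.Gamma_pos_of_pos hm0; positivity),
    ← ENNReal.ofReal_mul (by positivity)]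
  congr 1
  have h1 : Real.exp (-((b + u) * x)) = Real.exp (-(b * x)) * Real.exp (-(u * x)) := by
    rw [← Real.exp_add]; congr 1; ring
  have h2 : (1 + u / b) = (b + u) / b := by field_simp
  rw [h1, h2, zpow_neg, zpow_natCast, Real.rpow_natCast, Real.rpow_natCast, div_pow, inv_div]
  have : (b + u) ^ m ≠ 0 := by positivity
  field_simp

theorem ae_nonneg_gammaMeasure (a r : ℝ) : ∀ᵐ x ∂(gammaMeasure a r), 0 ≤ x := by
  rw [ae_iff]
  have : {x : ℝ | ¬ 0 ≤ x} = Set.Iio 0 := by ext; simp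
  rw [this, gammaMeasure, withDensity_apply _ measurableSet_Iio]
  exact lintegral_gammaPDF_of_nonpos le_rfl

end GammaDistribution

/-! ### Polar coordinates for the hovering disk and the lens. -/

section PolarCoordinates

/-- True for every real `t`, since `Real.arccos` is constantly `0` above `1` and `π` below `-1`.
Circles about `c` that miss, or lie inside, the second disk then need no separate formula. -/
theorem volume_setOf_le_cos (t : ℝ) :
    volume {θ ∈ Set.Ioo (-Real.pi) Real.pi | t ≤ Real.cos θ} =
      ENNReal.ofReal (2 * Real.arccos t) := by
  rcases lt_or_ge 1 t with h1 | h1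
  · have : {θ ∈ Set.Ioo (-Real.pi) Real.pi | t ≤ Real.cos θ} = ∅ := by
      ext θ
      simp only [Set.mem_ofPred_eq, Set.mem_empty_iff_false, iff_false, not_and, not_le]
      exact fun _ => (Real.cos_le_one θ).trans_lt h1
    rw [this, Real.arccos_of_one_le h1.le]
    simp
  -- `t = -1` belongs with the full circle: the closed interval of the last case would contain `±π`,
  -- which the open range of angles omits.
  rcases le_or_gt t (-1) with h2 | h2
  · have : {θ ∈ Set.Ioo (-Real.pi) Real.pi | t ≤ Real.cos θ} = Set.Ioo (-Real.pi) Real.pi := by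
      ext θ
      simp only [Set.mem_ofPred_eq, and_iff_left_iff_imp]
      exact fun _ => h2.trans (Real.neg_one_le_cos θ)
    rw [this, Real.arccos_of_le_neg_one h2, Real.volume_Ioo]
    ring_nf
  · have hlt : Real.arccos t < Real.pi := by
      refine (Real.arccos_le_pi t).lt_of_ne fun h => ?_
      rw [Real.arccos_eq_pi] at h
      exact h.not_gt h2
    have : {θ ∈ Set.Ioo (-Real.pi) Real.pi | t ≤ Real.cos θ} =
        Set.Icc (-Real.arccos t) (Real.arccos t) := by
      ext θ
      simp only [Set.mem_ofPred_eq, ← abs_le, Set.mem_Icc, Set.mem_Ioo, ← abs_lt]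
      have key : |θ| ≤ Real.pi → (t ≤ Real.cos θ ↔ |θ| ≤ Real.arccos t) := fun hθ => by
        have := Real.strictAntiOn_cos.le_iff_ge (a := Real.arccos t) (b := |θ|)
          ⟨Real.arccos_nonneg t, Real.arccos_le_pi t⟩ ⟨abs_nonneg θ, hθ⟩
        rw [Real.cos_arccos h2.le h1, Real.cos_abs] at this
        exact this
      exact ⟨fun h => (key h.1.le).1 h.2,
        fun h => ⟨h.trans_lt hlt, (key (h.trans hlt.le)).2 h⟩⟩
    rw [this, Real.volume_Icc]
    ring_nf

/-- A parametrization of the plane by `ℂ` taking `0` to `c` and `dist e c` to `e`. -/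
theorem exists_isometry_plane (c e : Plane) (hce : e ≠ c) :
    ∃ φ : ℂ → Plane, MeasurePreserving φ ∧ (∀ z, dist (φ z) c = ‖z‖) ∧
      ∀ z, dist (φ z) e = ‖z - (dist e c : ℂ)‖ := by
  set L := Complex.orthonormalBasisOneI.repr
  set w : ℂ := L.symm (e - c)
  have hw : ‖w‖ = dist e c := by rw [LinearIsometryEquiv.norm_map, dist_eq_norm]
  have hd : 0 < dist e c := dist_pos.2 hce
  have hw0 : w ≠ 0 := by rw [← norm_pos_iff, hw]; exact hd
  set u : Circle := ⟨w / (‖w‖ : ℂ), by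
    show w / (‖w‖ : ℂ) ∈ Metric.sphere (0 : ℂ) 1
    simp [hw0]⟩
  set M : ℂ ≃ₗᵢ[ℝ] Plane := (rotation u).trans L
  have hM : M (dist e c : ℂ) = e - c := by
    have : (rotation u) (dist e c : ℂ) = w := by
      rw [rotation_apply, ← hw]
      have : (‖w‖ : ℂ) ≠ 0 := by simpa using hw0
      show w / (‖w‖ : ℂ) * ‖w‖ = w
      field_simp
    show L ((rotation u) (dist e c : ℂ)) = e - c
    rw [this, LinearIsometryEquiv.apply_symm_apply]
  refine ⟨fun z => c + M z, (measurePreserving_add_left volume c).comp M.measurePreserving, fun z => ?_,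
    fun z => ?_⟩
  · rw [dist_eq_norm, add_sub_cancel_left, M.norm_map]
  · rw [dist_eq_norm, ← M.norm_map, map_sub, hM, sub_sub_eq_add_sub, add_comm (M z) c]

/-- Integration in polar coordinates about `c`, with angles measured from the direction of `e`. -/
theorem lintegral_dist_dist (c e : Plane) (hce : e ≠ c) {F : ℝ × ℝ → ℝ≥0∞} (hF : Measurable F) :
    ∫⁻ x, F (dist x c, dist x e) =
      ∫⁻ ρ in Set.Ioi 0, ENNReal.ofReal ρ * ∫⁻ θ in Set.Ioo (-Real.pi) Real.pi,
        F (ρ, Real.sqrt (ρ ^ 2 + dist e c ^ 2 - 2 * ρ * dist e c * Real.cos θ)) := by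
  obtain ⟨φ, hφ, h1, h2⟩ := exists_isometry_plane c e hce
  have hFm : Measurable fun x => F (dist x c, dist x e) := by fun_prop
  rw [← hφ.map_eq, lintegral_map hFm hφ.measurable]
  simp_rw [h1, h2]
  rw [← Complex.lintegral_comp_polarCoord_symm, polarCoord_target, Measure.volume_eq_prod]
  have hnorm : ∀ p : ℝ × ℝ, ‖Complex.polarCoord.symm p - (dist e c : ℂ)‖ =
      Real.sqrt (p.1 ^ 2 + dist e c ^ 2 - 2 * p.1 * dist e c * Real.cos p.2) := fun p => by
    rw [Complex.norm_def, Complex.polarCoord_symm_apply, Complex.normSq_apply]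
    congr 1
    simp only [Complex.sub_re, Complex.sub_im, Complex.mul_re, Complex.mul_im, Complex.ofReal_re,
      Complex.ofReal_im, Complex.add_re, Complex.add_im, Complex.I_re, Complex.I_im]
    linear_combination p.1 ^ 2 * Real.sin_sq_add_cos_sq p.2
  simp_rw [hnorm, Complex.norm_polarCoord_symm]
  rw [setLIntegral_prod _ (by fun_prop)]
  refine setLIntegral_congr_fun measurableSet_Ioi fun ρ hρ => ?_
  simp only [smul_eq_mul]
  rw [lintegral_const_mul _ (by fun_prop), abs_of_pos hρ]

/-- The substitution `r = √(h² + ρ²)`. -/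
theorem lintegral_comp_sqrt_add_sq {h a b : ℝ} (hh : 0 < h) (ha : 0 ≤ a) (hab : a ≤ b) (g : ℝ → ℝ≥0∞) :
    ∫⁻ r in Set.Ioc (Real.sqrt (h ^ 2 + a ^ 2)) (Real.sqrt (h ^ 2 + b ^ 2)), g r =
      ∫⁻ ρ in Set.Ioc a b, ENNReal.ofReal (ρ / Real.sqrt (h ^ 2 + ρ ^ 2)) *
        g (Real.sqrt (h ^ 2 + ρ ^ 2)) := by
  have himage : Set.Ioc (Real.sqrt (h ^ 2 + a ^ 2)) (Real.sqrt (h ^ 2 + b ^ 2)) =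
      (fun ρ => Real.sqrt (h ^ 2 + ρ ^ 2)) '' Set.Ioc a b := by
    ext r
    simp only [Set.mem_image, Set.mem_Ioc]
    constructor
    · rintro ⟨h1, h2⟩
      have hr : 0 < r := (Real.sqrt_nonneg _).trans_lt h1
      rw [Real.sqrt_lt' hr] at h1
      rw [Real.le_sqrt' hr] at h2
      refine ⟨Real.sqrt (r ^ 2 - h ^ 2), ⟨Real.lt_sqrt_of_sq_lt (by linarith),
        Real.sqrt_le_iff.2 ⟨ha.trans hab, by linarith⟩⟩, ?_⟩
      rw [Real.sq_sqrt (by nlinarith), add_sub_cancel, Real.sqrt_sq hr.le]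
    · rintro ⟨ρ, ⟨h1, h2⟩, rfl⟩
      exact ⟨Real.sqrt_lt_sqrt (by positivity) (by gcongr),
        Real.sqrt_le_sqrt (by have := ha.trans h1.le; gcongr)⟩
  have hinj : Set.InjOn (fun ρ => Real.sqrt (h ^ 2 + ρ ^ 2)) (Set.Ioc a b) := by
    intro x hx y hy hxy
    have := (Real.sqrt_inj (by positivity) (by positivity)).1 hxy
    have hx0 := ha.trans_lt hx.1
    have hy0 := ha.trans_lt hy.1
    nlinarith [(pow_left_inj₀ hx0.le hy0.le two_ne_zero).1 (by linarith)]
  rw [himage, lintegral_image_eq_lintegral_abs_deriv_mul measurableSet_Ioc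
    (f' := fun ρ => ρ / Real.sqrt (h ^ 2 + ρ ^ 2)) (fun ρ _ => ?_) hinj]
  · refine setLIntegral_congr_fun measurableSet_Ioc fun ρ hρ => ?_
    have := ha.trans hρ.1.le
    rw [abs_of_nonneg (by positivity)]
  · have h1 : HasDerivAt (fun ρ : ℝ => h ^ 2 + ρ ^ 2) (2 * ρ) ρ := by
      simpa using (hasDerivAt_pow 2 ρ).const_add (h ^ 2)
    refine ((h1.sqrt (by positivity)).congr_deriv ?_).hasDerivWithinAt
    field_simp

/-- The integrand is radial, so every circle contributes its full angle `2π`; `e` only fixes the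
direction from which angles are measured. -/
theorem lintegral_closedBall_uavDist (c e : Plane) {h R : ℝ} (hh : 0 < h) (hR : 0 < R)
    (he : dist e c = R) {f : ℝ → ℝ≥0∞} (hf : Measurable f) :
    ∫⁻ x in Metric.closedBall c R, f (uavDist c h x) =
      ∫⁻ r in Set.Ioc h (Real.sqrt (h ^ 2 + R ^ 2)),
        ENNReal.ofReal (2 * Real.pi * r) * f r := by
  have hce : e ≠ c := dist_pos.1 (he ▸ hR)
  have hs := lintegral_comp_sqrt_add_sq (b := R) hh le_rfl hR.le
    (fun r => ENNReal.ofReal (2 * Real.pi * r) * f r)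
  rw [show h ^ 2 + 0 ^ 2 = h ^ 2 by ring, Real.sqrt_sq hh.le] at hs
  rw [hs, ← lintegral_indicator measurableSet_closedBall]
  have hF : Measurable (Set.indicator {p : ℝ × ℝ | p.1 ≤ R}
      (fun p => f (Real.sqrt (p.1 ^ 2 + h ^ 2)))) :=
    Measurable.indicator (by fun_prop) (measurableSet_le measurable_fst measurable_const)
  calc ∫⁻ x, (Metric.closedBall c R).indicator (fun x => f (uavDist c h x)) x
      = ∫⁻ x, Set.indicator {p : ℝ × ℝ | p.1 ≤ R}
          (fun p => f (Real.sqrt (p.1 ^ 2 + h ^ 2))) (dist x c, dist x e) := by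
        refine lintegral_congr fun x => ?_
        simp [Set.indicator, uavDist]
    _ = ∫⁻ ρ in Set.Ioi 0, (Set.Iic R).indicator (fun ρ =>
          ENNReal.ofReal (2 * Real.pi * ρ) * f (Real.sqrt (h ^ 2 + ρ ^ 2))) ρ := by
        rw [lintegral_dist_dist c e hce hF]
        refine setLIntegral_congr_fun measurableSet_Ioi fun ρ hρ => ?_
        simp only [Set.indicator, Set.mem_ofPred_eq, Set.mem_Iic, lintegral_const,
          Measure.restrict_apply_univ, Real.volume_Ioo]
        split_ifs
        · rw [mul_comm (f _), ← mul_assoc, ← ENNReal.ofReal_mul (le_of_lt hρ), add_comm (ρ ^ 2)]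
          ring_nf
        · simp
    _ = _ := by
        rw [lintegral_indicator measurableSet_Iic, Measure.restrict_restrict measurableSet_Iic,
          Set.inter_comm, Set.Ioi_inter_Iic]
        refine setLIntegral_congr_fun measurableSet_Ioc fun ρ hρ => ?_
        have := hρ.1
        rw [← mul_assoc, ← ENNReal.ofReal_mul (by positivity)]
        congr 2
        have : Real.sqrt (h ^ 2 + ρ ^ 2) ≠ 0 := by positivity
        field_simp

/-- On the circle of radius `ρ` about `c`, the law of cosines makes membership in the second disk a
lower bound `t ρ` on `cos θ`, an arc of angle `2 arccos (t ρ)`. As `Rmse ≤ R`, the lens starts at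
the nonnegative radius `R - Rmse`. -/
theorem lintegral_lens_uavDist (c e : Plane) {h R Rmse : ℝ} (hh : 0 < h) (hRmse : 0 < Rmse)
    (hle : Rmse ≤ R) (he : dist e c = R) {f : ℝ → ℝ≥0∞} (hf : Measurable f) :
    ∫⁻ x in Metric.closedBall e Rmse ∩ Metric.closedBall c R, f (uavDist c h x) =
      ∫⁻ r in Set.Ioc (Real.sqrt (h ^ 2 + (R - Rmse) ^ 2)) (Real.sqrt (h ^ 2 + R ^ 2)),
        ENNReal.ofReal (2 * r * Real.arccos
          ((R ^ 2 + r ^ 2 - h ^ 2 - Rmse ^ 2) / (2 * R * Real.sqrt (r ^ 2 - h ^ 2)))) * f r := by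
  have hR : 0 < R := hRmse.trans_le hle
  have hce : e ≠ c := dist_pos.1 (he ▸ hR)
  rw [lintegral_comp_sqrt_add_sq hh (sub_nonneg.2 hle) (by linarith),
    ← lintegral_indicator (measurableSet_closedBall.inter measurableSet_closedBall)]
  set t : ℝ → ℝ := fun ρ => (ρ ^ 2 + R ^ 2 - Rmse ^ 2) / (2 * R * ρ)
  have hF : Measurable (Set.indicator {p : ℝ × ℝ | p.1 ≤ R ∧ p.2 ≤ Rmse}
      (fun p => f (Real.sqrt (p.1 ^ 2 + h ^ 2)))) :=
    Measurable.indicator (by fun_prop) ((measurableSet_le measurable_fst measurable_const).inter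
      (measurableSet_le measurable_snd measurable_const))
  calc ∫⁻ x, (Metric.closedBall e Rmse ∩ Metric.closedBall c R).indicator
        (fun x => f (uavDist c h x)) x
      = ∫⁻ x, Set.indicator {p : ℝ × ℝ | p.1 ≤ R ∧ p.2 ≤ Rmse}
          (fun p => f (Real.sqrt (p.1 ^ 2 + h ^ 2))) (dist x c, dist x e) := by
        refine lintegral_congr fun x => ?_
        simp [Set.indicator, uavDist, and_comm]
    _ = ∫⁻ ρ in Set.Ioi 0, (Set.Ioc (R - Rmse) R).indicator (fun ρ =>
          ENNReal.ofReal (2 * ρ * Real.arccos (t ρ)) * f (Real.sqrt (h ^ 2 + ρ ^ 2))) ρ := by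
        rw [lintegral_dist_dist c e hce hF, he]
        refine setLIntegral_congr_fun measurableSet_Ioi fun ρ hρ => ?_
        have hρ0 : 0 < ρ := hρ
        have hcos : ∀ θ, Real.sqrt (ρ ^ 2 + R ^ 2 - 2 * ρ * R * Real.cos θ) ≤ Rmse ↔
            t ρ ≤ Real.cos θ := fun θ => by
          rw [Real.sqrt_le_left hRmse.le, div_le_iff₀ (by positivity)]
          constructor <;> intro h <;> linarith
        have hinner : ∫⁻ θ in Set.Ioo (-Real.pi) Real.pi,
            Set.indicator {p : ℝ × ℝ | p.1 ≤ R ∧ p.2 ≤ Rmse}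
              (fun p => f (Real.sqrt (p.1 ^ 2 + h ^ 2)))
              (ρ, Real.sqrt (ρ ^ 2 + R ^ 2 - 2 * ρ * R * Real.cos θ)) =
            (if ρ ≤ R then f (Real.sqrt (ρ ^ 2 + h ^ 2)) else 0) *
              ENNReal.ofReal (2 * Real.arccos (t ρ)) := by
          have hmeas : MeasurableSet {θ : ℝ | t ρ ≤ Real.cos θ} :=
            measurableSet_le measurable_const Real.measurable_cos
          have hset : volume ({θ : ℝ | t ρ ≤ Real.cos θ} ∩ Set.Ioo (-Real.pi) Real.pi) =
              ENNReal.ofReal (2 * Real.arccos (t ρ)) := by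
            rw [← volume_setOf_le_cos]
            congr 1
            ext θ
            simp [and_comm]
          rw [← hset, ← Measure.restrict_apply hmeas, ← lintegral_indicator_const hmeas]
          refine lintegral_congr fun θ => ?_
          simp only [Set.indicator, Set.mem_ofPred_eq, hcos]
          by_cases h1 : ρ ≤ R <;> simp [h1]
        rw [hinner]
        by_cases h1 : ρ ≤ R
        · by_cases h2 : R - Rmse < ρ
          · rw [Set.indicator_of_mem (Set.mem_Ioc.2 ⟨h2, h1⟩), if_pos h1,
              mul_comm (f _), ← mul_assoc, ← ENNReal.ofReal_mul hρ0.le, add_comm (ρ ^ 2)]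
            ring_nf
          -- Here `R - ρ ≥ Rmse`, so `(R - ρ)² ≥ Rmse²`, which says `t ρ ≥ 1`: the arc is null.
          · rw [Set.indicator_of_notMem (fun h => h2 h.1), Real.arccos_of_one_le]
            · simp
            · rw [le_div_iff₀ (by positivity)]
              nlinarith [not_lt.1 h2]
        · rw [Set.indicator_of_notMem (fun h => h1 h.2), if_neg h1]
          simp
    _ = _ := by
        rw [lintegral_indicator measurableSet_Ioc, Measure.restrict_restrict measurableSet_Ioc]
        have : Set.Ioc (R - Rmse) R ∩ Set.Ioi 0 = Set.Ioc (R - Rmse) R :=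
          Set.inter_eq_left.2 fun ρ hρ => (sub_nonneg.2 hle).trans_lt hρ.1
        rw [this]
        refine setLIntegral_congr_fun measurableSet_Ioc fun ρ hρ => ?_
        have hρ0 : 0 < ρ := (sub_nonneg.2 hle).trans_lt hρ.1
        have hsq : Real.sqrt (h ^ 2 + ρ ^ 2) ^ 2 = h ^ 2 + ρ ^ 2 := Real.sq_sqrt (by positivity)
        rw [← mul_assoc, ← ENNReal.ofReal_mul (by positivity), hsq, add_sub_cancel_left,
          Real.sqrt_sq hρ0.le]
        have : Real.sqrt (h ^ 2 + ρ ^ 2) ≠ 0 := by positivity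
        congr 2
        rw [show R ^ 2 + (h ^ 2 + ρ ^ 2) - h ^ 2 - Rmse ^ 2 = ρ ^ 2 + R ^ 2 - Rmse ^ 2 by ring]
        simp only [t]
        field_simp

end PolarCoordinates

/-! ### Law of a single device and its received power. -/

section NodeLaw

/-- The joint law of position, transmission decision and fading gain of a device. -/
noncomputable def nodeLaw (A : Set Plane) (a : unitInterval) (m : ℕ) : Measure (Plane × Bool × ℝ) :=
  (cond volume A).prod ((bernoulliMeasure true false a).prod (gammaMeasure m m))

@[fun_prop]
theorem measurable_uavDist (c : Plane) (h : ℝ) : Measurable (uavDist c h) := by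
  unfold uavDist; fun_prop

theorem uavDist_pos (c : Plane) {h : ℝ} (hh : 0 < h) (x : Plane) : 0 < uavDist c h x := by
  unfold uavDist; positivity

open Classical in
/-- The normalized power received at the UAV from a device, `0` if the device is outside the
hovering disk or does not transmit. -/
noncomputable def receivedPower (c : Plane) (h R η : ℝ) (z : Plane × Bool × ℝ) : ℝ :=
  if z.1 ∈ Metric.closedBall c R ∧ z.2.1 = true then z.2.2 * uavDist c h z.1 ^ (-η) else 0

theorem measurableSet_transmitting {B : Set Plane} (hB : MeasurableSet B) :
    MeasurableSet {z : Plane × Bool × ℝ | z.1 ∈ B ∧ z.2.1 = true} :=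
  (measurable_fst hB).inter ((measurable_fst.comp measurable_snd) (measurableSet_singleton true))

@[fun_prop]
theorem measurable_receivedPower (c : Plane) (h R η : ℝ) : Measurable (receivedPower c h R η) := by
  unfold receivedPower
  exact Measurable.ite (measurableSet_transmitting measurableSet_closedBall) (by fun_prop)
    measurable_const

theorem receivedPower_nonneg (c : Plane) (h R η : ℝ) {z : Plane × Bool × ℝ} (hz : 0 ≤ z.2.2) :
    0 ≤ receivedPower c h R η z := by
  have : 0 ≤ uavDist c h z.1 := Real.sqrt_nonneg _
  unfold receivedPower
  split_ifs <;> positivity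

variable {A : Set Plane} {a : unitInterval} {m : ℕ}

theorem lintegral_bernoulliMeasure_true_false (a : unitInterval) (F : Bool → ℝ≥0∞) :
    ∫⁻ t, F t ∂(bernoulliMeasure true false a) =
      ENNReal.ofReal a * F true + ENNReal.ofReal (1 - a) * F false := by
  rw [bernoulliMeasure_def, lintegral_add_measure, lintegral_smul_measure, lintegral_smul_measure,
    lintegral_dirac, lintegral_dirac]
  rw [ENNReal.smul_def, ENNReal.smul_def, smul_eq_mul, smul_eq_mul, ← ENNReal.ofReal_coe_nnreal,
    ← ENNReal.ofReal_coe_nnreal]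
  rfl

theorem ae_nodeLaw_nonneg (hm : 1 ≤ m) : ∀ᵐ z ∂(nodeLaw A a m), 0 ≤ z.2.2 := by
  have hm0 : (0 : ℝ) < m := by exact_mod_cast hm
  have := isProbabilityMeasure_gammaMeasure hm0 hm0
  have h1 : ∀ᵐ y ∂((bernoulliMeasure true false a).prod (gammaMeasure m m)), 0 ≤ y.2 :=
    Measure.quasiMeasurePreserving_snd.ae (ae_nonneg_gammaMeasure m m)
  exact Measure.quasiMeasurePreserving_snd.ae h1

/-- Integrals over the transmitting devices in a region `B`. -/
theorem lintegral_nodeLaw_of_support (hA : MeasurableSet A) (hm : 1 ≤ m) {B : Set Plane}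
    (hB : MeasurableSet B) (hBA : B ⊆ A) {F : Plane × Bool × ℝ → ℝ≥0∞} (hF : Measurable F)
    (hF0 : ∀ z, ¬ (z.1 ∈ B ∧ z.2.1 = true) → F z = 0) :
    ∫⁻ z, F z ∂(nodeLaw A a m) = (volume A)⁻¹ * (ENNReal.ofReal a *
      ∫⁻ x in B, ∫⁻ g, F (x, true, g) ∂(gammaMeasure m m)) := by
  have hm0 : (0 : ℝ) < m := by exact_mod_cast hm
  have := isProbabilityMeasure_gammaMeasure hm0 hm0
  rw [nodeLaw, lintegral_prod _ hF.aemeasurable, ProbabilityTheory.cond, lintegral_smul_measure, smul_eq_mul]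
  congr 1
  have hinner : ∀ x, ∫⁻ y, F (x, y) ∂((bernoulliMeasure true false a).prod (gammaMeasure m m)) =
      ENNReal.ofReal a * ∫⁻ g, F (x, true, g) ∂(gammaMeasure m m) := fun x => by
    rw [lintegral_prod (fun y => F (x, y)) (hF.comp measurable_prodMk_left).aemeasurable,
      lintegral_bernoulliMeasure_true_false]
    have : ∀ g, F (x, false, g) = 0 := fun g => hF0 _ (by simp)
    simp [this]
  simp_rw [hinner]
  have hm1 : Measurable fun x => ∫⁻ g, F (x, true, g) ∂(gammaMeasure m m) :=
    Measurable.lintegral_prod_right' (f := fun p : Plane × ℝ => F (p.1, true, p.2)) (by fun_prop)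
  rw [lintegral_const_mul _ hm1]
  congr 1
  rw [← lintegral_indicator hA, ← lintegral_indicator hB]
  refine lintegral_congr fun x => ?_
  by_cases hx : x ∈ B
  · rw [Set.indicator_of_mem hx, Set.indicator_of_mem (hBA hx)]
  · rw [Set.indicator_of_notMem hx]
    have : ∀ g, F (x, true, g) = 0 := fun g => hF0 _ (by simp [hx])
    simp [Set.indicator, this]

end NodeLaw

/-! ### Laplace transform of one device's received power. -/

section Network

variable {Ω : Type*} [MeasurableSpace Ω]

/-- The random count takes countably many values, so measurability for each fixed count suffices. -/
theorem measurable_apply_count {E : Type*} [MeasurableSpace E] {β : Type*} [MeasurableSpace β]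
    {Z : ℕ → Ω → E} {N : Ω → ℕ}
    (hZ : ∀ n, Measurable (Z n)) (hN : Measurable N) {F : ℕ → (ℕ → E) → β}
    (hF : ∀ k, Measurable (F k)) : Measurable fun ω => F (N ω) (fun n => Z n ω) :=
  (measurable_from_prod_countable_right (f := fun p : ℕ × (ℕ → E) => F p.1 p.2) hF).comp
    (hN.prodMk (measurable_pi_lambda _ hZ))

variable {A : Set Plane} {a : unitInterval} {m : ℕ}

/-- The Laplace transform of the received power of a single device. -/
theorem lintegral_exp_neg_receivedPower (hA : MeasurableSet A) (hAfin : volume A ≠ ⊤) (hm : 1 ≤ m)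
    [IsProbabilityMeasure (nodeLaw A a m)]
    {c e : Plane} {h R η s : ℝ} (hh : 0 < h) (hR : 0 < R) (hs : 0 ≤ s)
    (hdisk : Metric.closedBall c R ⊆ A) (hedge : dist e c = R) :
    ∃ p : ℝ, 0 ≤ p ∧ (volume A).toReal * (1 - p) = 2 * Real.pi * a *
        ∫ r in h..Real.sqrt (h ^ 2 + R ^ 2), (1 - (1 + s * r ^ (-η) / m) ^ (-(m : ℤ))) * r ∧
      ∫⁻ z, ENNReal.ofReal (Real.exp (-(s * receivedPower c h R η z))) ∂(nodeLaw A a m) =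
        ENNReal.ofReal p := by
  have hm0 : (0 : ℝ) < m := by exact_mod_cast hm
  have := isProbabilityMeasure_gammaMeasure hm0 hm0
  have hV : 0 < (volume A).toReal := by
    refine ENNReal.toReal_pos (fun h0 => ?_) hAfin
    have h1 : volume (Metric.closedBall c R) = 0 := measure_mono_null hdisk h0
    exact (Metric.measure_closedBall_pos volume c hR).ne' h1
  set k : ℝ → ℝ := fun r => 1 - (1 + s * r ^ (-η) / m) ^ (-(m : ℤ))
  have hk01 : ∀ r, 0 < r → 0 ≤ k r ∧ k r ≤ 1 := fun r hr => by
    have h1 : (1 : ℝ) ≤ 1 + s * r ^ (-η) / m := by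
      have : 0 ≤ s * r ^ (-η) / m := by positivity
      linarith
    have h2 : 0 < (1 + s * r ^ (-η) / m) ^ (-(m : ℤ)) := by positivity
    have h3 : (1 + s * r ^ (-η) / m) ^ (-(m : ℤ)) ≤ 1 := by
      rw [zpow_neg, zpow_natCast]
      exact inv_le_one_of_one_le₀ (one_le_pow₀ h1)
    exact ⟨by simp only [k]; linarith, by simp only [k]; linarith⟩
  have hkm : Measurable k := by
    simp only [k, zpow_neg, zpow_natCast]; fun_prop
  set d := Real.sqrt (h ^ 2 + R ^ 2)
  have hhd : h ≤ d := Real.le_sqrt_of_sq_le (by nlinarith)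
  set J : ℝ := ∫ r in h..d, k r * r with hJ
  -- Unlike the exponential itself, `1 - exp` vanishes for devices that are silent or outside the
  -- disk, so the integral reduces to the disk; the exponential is recovered by complement in
  -- `hadd`.
  have hq : ∫⁻ z, ENNReal.ofReal (1 - Real.exp (-(s * receivedPower c h R η z))) ∂(nodeLaw A a m) =
      ENNReal.ofReal ((volume A).toReal⁻¹ * (a * (2 * Real.pi * J))) := by
    rw [lintegral_nodeLaw_of_support hA hm measurableSet_closedBall hdisk (by fun_prop)
      (fun z hz => by rw [receivedPower, if_neg hz]; simp)]
    have hinner : ∀ x ∈ Metric.closedBall c R, ∫⁻ g, ENNReal.ofReal (1 - Real.exp (-(s *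
        receivedPower c h R η (x, true, g)))) ∂(gammaMeasure m m) =
        ENNReal.ofReal (k (uavDist c h x)) := fun x hx => by
      have hD := uavDist_pos c hh x
      have h1 : ∀ g, s * receivedPower c h R η (x, true, g) = s * uavDist c h x ^ (-η) * g :=
        fun g => by rw [receivedPower, if_pos ⟨hx, rfl⟩]; ring
      simp_rw [h1]
      have hu : 0 ≤ s * uavDist c h x ^ (-η) := by positivity
      have hL := lintegral_exp_neg_mul_gammaMeasure hm hm0 hu
      simp_rw [ENNReal.ofReal_sub 1 (Real.exp_nonneg _)]
      rw [lintegral_sub (by fun_prop) (by rw [hL]; exact ENNReal.ofReal_ne_top), hL]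
      · simp only [k]
        rw [ENNReal.ofReal_sub _ (by positivity)]
        simp
      · filter_upwards [ae_nonneg_gammaMeasure m m] with g hg
        apply ENNReal.ofReal_le_ofReal
        rw [Real.exp_le_one_iff]
        have := mul_nonneg hu hg
        linarith
    rw [setLIntegral_congr_fun measurableSet_closedBall hinner,
      lintegral_closedBall_uavDist (f := fun r => ENNReal.ofReal (k r)) c e hh hR hedge (by fun_prop)]
    have hint : IntegrableOn (fun r => 2 * Real.pi * (k r * r)) (Set.Ioc h d) := by
      refine Measure.integrableOn_of_bounded (M := 2 * Real.pi * d) (by simp)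
        (by fun_prop) ?_
      refine (ae_restrict_iff' measurableSet_Ioc).2 (Filter.Eventually.of_forall fun r hr => ?_)
      have hr0 : 0 < r := hh.trans hr.1
      obtain ⟨h1, h2⟩ := hk01 r hr0
      rw [Real.norm_of_nonneg (by positivity)]
      have : k r * r ≤ 1 * d := mul_le_mul h2 hr.2 hr0.le zero_le_one
      rw [one_mul] at this
      gcongr
    have hJ' : 2 * Real.pi * J = ∫ r in Set.Ioc h d, 2 * Real.pi * (k r * r) := by
      rw [integral_const_mul, hJ, intervalIntegral.integral_of_le hhd]
    rw [hJ', ENNReal.ofReal_mul (by positivity), ENNReal.ofReal_mul a.2.1,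
      ofReal_integral_eq_lintegral_ofReal hint ((ae_restrict_iff' measurableSet_Ioc).2
        (Filter.Eventually.of_forall fun r hr => by
          have hr0 : 0 < r := hh.trans hr.1
          have := (hk01 r hr0).1
          positivity)),
      ENNReal.ofReal_inv_of_pos hV, ENNReal.ofReal_toReal hAfin]
    congr 2
    refine setLIntegral_congr_fun measurableSet_Ioc fun r hr => ?_
    have hr0 : 0 < r := hh.trans hr.1
    rw [← ENNReal.ofReal_mul (by positivity)]
    ring_nf
  have hadd : ∫⁻ z, ENNReal.ofReal (Real.exp (-(s * receivedPower c h R η z))) ∂(nodeLaw A a m) +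
      ∫⁻ z, ENNReal.ofReal (1 - Real.exp (-(s * receivedPower c h R η z))) ∂(nodeLaw A a m) = 1 := by
    rw [← lintegral_add_left (by fun_prop), lintegral_congr_ae (g := fun _ => 1)]
    · simp
    · filter_upwards [ae_nodeLaw_nonneg hm] with z hz
      have h0 := mul_nonneg hs (receivedPower_nonneg c h R η hz)
      rw [← ENNReal.ofReal_add (Real.exp_nonneg _)]
      · simp
      · rw [sub_nonneg, Real.exp_le_one_iff]; linarith
  have hJ0 : 0 ≤ J := by
    rw [hJ]
    refine intervalIntegral.integral_nonneg hhd fun r hr => ?_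
    have hr0 : 0 < r := hh.trans_le hr.1
    exact mul_nonneg (hk01 r hr0).1 hr0.le
  refine ⟨1 - (volume A).toReal⁻¹ * (a * (2 * Real.pi * J)), ?_, ?_, ?_⟩
  · rw [sub_nonneg, ← ENNReal.ofReal_le_one, ← hq, ← hadd]
    exact le_add_self
  · field_simp
    ring
  · rw [ENNReal.ofReal_sub _ (by have := a.2.1; positivity), ENNReal.ofReal_one, ← hq, ← hadd,
      ENNReal.add_sub_cancel_right (by rw [hq]; exact ENNReal.ofReal_ne_top)]

end Network

/-! ### Transform of the interference and expected number of successes. -/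

section MeasurableNetwork

variable {Ω : Type*} [MeasurableSpace Ω] {μ : Measure Ω}
  {A : Set Plane} {lam : ℝ≥0} {a : unitInterval} {m : ℕ}
  {Z : ℕ → Ω → Plane × Bool × ℝ} {N : Ω → ℕ}

theorem measurable_sum_receivedPower (hZ : ∀ n, Measurable (Z n)) (hN : Measurable N)
    (c : Plane) (h R η : ℝ) :
    Measurable fun ω => ∑ j ∈ Finset.range (N ω), receivedPower c h R η (Z j ω) :=
  measurable_apply_count (F := fun k v => ∑ j ∈ Finset.range k, receivedPower c h R η (v j)) hZ hN
    fun _ => Finset.measurable_sum _ fun j _ =>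
      (measurable_receivedPower c h R η).comp (measurable_pi_apply j)

theorem ae_nonneg_gain (hZ : ∀ n, Measurable (Z n)) (hlaw : ∀ n, μ.map (Z n) = nodeLaw A a m)
    (hm : 1 ≤ m) : ∀ᵐ ω ∂μ, ∀ n, 0 ≤ (Z n ω).2.2 :=
  ae_all_iff.2 fun n =>
    ae_of_ae_map (p := fun z : Plane × Bool × ℝ => 0 ≤ z.2.2) (hZ n).aemeasurable
      (by rw [hlaw n]; exact ae_nodeLaw_nonneg hm)

/-- The Laplace transform of the interference, in terms of the total received power. -/
theorem integral_exp_neg_sum_receivedPower [IsProbabilityMeasure μ] (hZ : ∀ n, Measurable (Z n))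
    (hlaw : ∀ n, μ.map (Z n) = nodeLaw A a m) (hind : iIndepFun Z μ) (hN : Measurable N)
    (hNlaw : μ.map N = poissonMeasure (lam * (volume A).toNNReal))
    (hNZ : IndepFun N (fun ω n => Z n ω) μ)
    (hA : MeasurableSet A) (hAfin : volume A ≠ ⊤) (hm : 1 ≤ m)
    {c e : Plane} {h R η Ptx σ2 s : ℝ} (hh : 0 < h) (hR : 0 < R) (hs : 0 ≤ s)
    (hdisk : Metric.closedBall c R ⊆ A) (hedge : dist e c = R) :
    ∫ ω, Real.exp (-s * (∑ j ∈ Finset.range (N ω), receivedPower c h R η (Z j ω) + σ2 / Ptx)) ∂μ =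
      laplaceI lam a h R η Ptx σ2 m s := by
  have : IsProbabilityMeasure (nodeLaw A a m) :=
    hlaw 0 ▸ Measure.isProbabilityMeasure_map (hZ 0).aemeasurable
  obtain ⟨p, hp0, hp1, hp2⟩ := lintegral_exp_neg_receivedPower (a := a) (η := η) hA hAfin hm hh hR hs hdisk hedge
  have hmeas := measurable_sum_receivedPower hZ hN c h R η
  have h1 := integral_exp_neg_sum_poisson hZ hlaw hind hN hNlaw hNZ
    (u := fun z => Real.exp (-(s * receivedPower c h R η z))) (by fun_prop) hp0 hp2
  have h2 : ∀ ω, Real.exp (-s * (∑ j ∈ Finset.range (N ω), receivedPower c h R η (Z j ω) + σ2 / Ptx)) =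
      Real.exp (-s * σ2 / Ptx) *
        Real.exp (-s * ∑ j ∈ Finset.range (N ω), receivedPower c h R η (Z j ω)) := fun ω => by
    rw [← Real.exp_add]; ring_nf
  simp_rw [h2]
  rw [integral_const_mul, laplaceI]
  congr 1
  rw [integral_eq_lintegral_of_nonneg_ae (Filter.Eventually.of_forall fun ω => Real.exp_nonneg _)
    (hmeas.const_mul _).exp.aestronglyMeasurable]
  have h3 : ∀ ω, ENNReal.ofReal (Real.exp (-s * ∑ j ∈ Finset.range (N ω),
      receivedPower c h R η (Z j ω))) = ∏ n ∈ Finset.range (N ω),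
      ENNReal.ofReal (Real.exp (-(s * receivedPower c h R η (Z n ω)))) := fun ω => by
    rw [← ENNReal.ofReal_prod_of_nonneg (fun _ _ => Real.exp_nonneg _), ← Real.exp_sum,
      Finset.mul_sum]
    simp only [neg_mul]
  simp_rw [h3]
  rw [h1, ENNReal.toReal_ofReal (Real.exp_nonneg _)]
  congr 1
  push_cast
  -- The Poisson mean is `lam * |A|`, and `hp1` evaluates `|A| * (1 - p)`, so the area of the field
  -- disappears.
  linear_combination (-(lam : ℝ)) * hp1

/-- For nonnegative `Y` with Laplace transform `L`, the expectation of a Gamma tail at `s * Y` is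
given by the derivatives of `L` at `s`. -/
theorem sum_iteratedDeriv_laplace [IsProbabilityMeasure μ] {Y : Ω → ℝ} (hY : Measurable Y) (hY0 : ∀ᵐ ω ∂μ, 0 ≤ Y ω)
    {L : ℝ → ℝ} (hL : ∀ s, 0 ≤ s → ∫ ω, Real.exp (-s * Y ω) ∂μ = L s) (m : ℕ) {s : ℝ} (hs : 0 < s) :
    ∑ k ∈ Finset.range m, (-s) ^ k / (k.factorial : ℝ) * iteratedDeriv k L s =
      ∫ ω, erlangTail m (s * Y ω) ∂μ := by
  -- Since `Y ≥ 0`, the moment generating function of `-Y` is finite on `[0, ∞)`; `s > 0` is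
  -- interior, which permits differentiation under the expectation.
  have hsub : Set.Ici (0 : ℝ) ⊆ integrableExpSet (fun ω => -Y ω) μ := fun t ht => by
    refine Integrable.of_bound (C := 1) (by fun_prop) ?_
    filter_upwards [hY0] with ω hω
    rw [Real.norm_of_nonneg (Real.exp_nonneg _), Real.exp_le_one_iff]
    have := mul_nonneg (Set.mem_Ici.1 ht) hω
    linarith
  have hmem : s ∈ interior (integrableExpSet (fun ω => -Y ω) μ) :=
    interior_mono hsub (by rw [interior_Ici]; exact hs)
  -- `L` is known only at nonnegative arguments, but derivatives at `s > 0` need only agreement near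
  -- `s`.
  have heq : L =ᶠ[nhds s] mgf (fun ω => -Y ω) μ := by
    filter_upwards [lt_mem_nhds hs] with t ht
    rw [← hL t ht.le, mgf]
    simp only [neg_mul, mul_neg]
  have hterm : ∀ k, (-s) ^ k / (k.factorial : ℝ) * iteratedDeriv k L s =
      ∫ ω, (-s) ^ k / (k.factorial : ℝ) * ((-Y ω) ^ k * Real.exp (s * (-Y ω))) ∂μ := fun k => by
    rw [heq.iteratedDeriv_eq, iteratedDeriv_mgf hmem, integral_const_mul]
  rw [Finset.sum_congr rfl fun k _ => hterm k, ← integral_finsetSum]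
  · refine integral_congr_ae (Filter.Eventually.of_forall fun ω => ?_)
    simp only [erlangTail]
    rw [Finset.mul_sum]
    refine Finset.sum_congr rfl fun k _ => ?_
    rw [mul_neg, mul_pow s, neg_pow s, neg_pow (Y ω)]
    have : ((-1 : ℝ) ^ k) * (-1) ^ k = 1 := by rw [← mul_pow]; simp
    linear_combination (s ^ k * Y ω ^ k / (k.factorial : ℝ) * Real.exp (-(s * Y ω))) * this
  · exact fun k _ => (integrable_pow_mul_exp_of_mem_interior_integrableExpSet hmem k).const_mul _

open Classical in
/-- Indicator that a transmitting device of the region `B`, exposed to the power `w` of the other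
transmitters, is received with SINR at least `β`. -/
noncomputable def successIndicator (c : Plane) (h η Ptx σ2 β : ℝ) (B : Set Plane)
    (p : (Plane × Bool × ℝ) × ℝ) : ℝ≥0∞ :=
  if (p.1.1 ∈ B ∧ p.1.2.1 = true) ∧
    β * (p.2 + σ2 / Ptx) ≤ p.1.2.2 * uavDist c h p.1.1 ^ (-η) then 1 else 0

@[fun_prop]
theorem measurable_successIndicator (c : Plane) (h η Ptx σ2 β : ℝ) {B : Set Plane}
    (hB : MeasurableSet B) : Measurable (successIndicator c h η Ptx σ2 β B) := by
  unfold successIndicator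
  exact Measurable.ite ((measurable_fst (measurableSet_transmitting hB)).inter
    (measurableSet_le (f := fun p : (Plane × Bool × ℝ) × ℝ => β * (p.2 + σ2 / Ptx))
      (g := fun p => p.1.2.2 * uavDist c h p.1.1 ^ (-η)) (by fun_prop) (by fun_prop)))
    measurable_const measurable_const

/-- The expected number of successful devices in the lens, as an integral over the distance. -/
theorem lintegral_sum_successIndicator [IsProbabilityMeasure μ] (hZ : ∀ n, Measurable (Z n))
    (hlaw : ∀ n, μ.map (Z n) = nodeLaw A a m) (hind : iIndepFun Z μ) (hN : Measurable N)
    (hNlaw : μ.map N = poissonMeasure (lam * (volume A).toNNReal))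
    (hNZ : IndepFun N (fun ω n => Z n ω) μ)
    (hA : MeasurableSet A) (hAfin : volume A ≠ ⊤) (hm : 1 ≤ m)
    {c e : Plane} {h R Rmse η Ptx σ2 β : ℝ} (hh : 0 < h) (hPtx : 0 < Ptx)
    (hσ2 : 0 < σ2) (hβ : 0 < β) (hRmse : 0 < Rmse) (hRmseR : Rmse ≤ R)
    (hdisk : Metric.closedBall c R ⊆ A) (hedge : dist e c = R) :
    ∫⁻ ω, ∑ n ∈ Finset.range (N ω), successIndicator c h η Ptx σ2 β
        (Metric.closedBall e Rmse ∩ Metric.closedBall c R)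
        (Z n ω, ∑ j ∈ (Finset.range (N ω)).erase n, receivedPower c h R η (Z j ω)) ∂μ =
      lam * ENNReal.ofReal a * ∫⁻ r in Set.Ioc (Real.sqrt (h ^ 2 + (R - Rmse) ^ 2))
        (Real.sqrt (h ^ 2 + R ^ 2)), ENNReal.ofReal (2 * r * Real.arccos
          ((R ^ 2 + r ^ 2 - h ^ 2 - Rmse ^ 2) / (2 * R * Real.sqrt (r ^ 2 - h ^ 2)))) *
        ∫⁻ ω, ENNReal.ofReal (erlangTail m (m * β * r ^ η *
          (∑ j ∈ Finset.range (N ω), receivedPower c h R η (Z j ω) + σ2 / Ptx))) ∂μ := by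
  have hm0 : (0 : ℝ) < m := by exact_mod_cast hm
  have := isProbabilityMeasure_gammaMeasure hm0 hm0
  set B := Metric.closedBall e Rmse ∩ Metric.closedBall c R
  have hB : MeasurableSet B := measurableSet_closedBall.inter measurableSet_closedBall
  have hV : volume A ≠ 0 := fun h0 =>
    (Metric.measure_closedBall_pos volume c (hRmse.trans_le hRmseR)).ne' (measure_mono_null hdisk h0)
  have hW := measurable_sum_receivedPower hZ hN c h R η
  set W : Ω → ℝ := fun ω => ∑ j ∈ Finset.range (N ω), receivedPower c h R η (Z j ω)
  have hW0 : ∀ᵐ ω ∂μ, 0 ≤ W ω := by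
    filter_upwards [ae_nonneg_gain hZ hlaw hm] with ω hω
    exact Finset.sum_nonneg fun j _ => receivedPower_nonneg c h R η (hω j)
  have hf := measurable_successIndicator c h η Ptx σ2 β hB
  rw [lintegral_sum_poisson hZ hlaw hind hN hNlaw hNZ (measurable_receivedPower c h R η) hf]
  rw [lintegral_nodeLaw_of_support hA hm hB (Set.inter_subset_right.trans hdisk)
    (Measurable.lintegral_prod_right' (f := fun p : (Plane × Bool × ℝ) × Ω =>
      successIndicator c h η Ptx σ2 β B (p.1, W p.2))
      (hf.comp (measurable_fst.prodMk (hW.comp measurable_snd))))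
    (fun z hz => by simp [successIndicator, hz])]
  have hinner : ∀ x ∈ B, ∫⁻ g, ∫⁻ ω, successIndicator c h η Ptx σ2 β B ((x, true, g), W ω) ∂μ
      ∂(gammaMeasure m m) = ∫⁻ ω, ENNReal.ofReal (erlangTail m (m * β * uavDist c h x ^ η *
          (W ω + σ2 / Ptx))) ∂μ := fun x hx => by
    have hD := uavDist_pos c hh x
    -- Integrating over the gain first, with the interference frozen, leaves a Gamma tail.
    rw [lintegral_lintegral_swap (by
      exact (hf.comp (by fun_prop : Measurable fun p : ℝ × Ω =>
        (((x, true, p.1), W p.2) : (Plane × Bool × ℝ) × ℝ))).aemeasurable)]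
    refine lintegral_congr_ae ?_
    filter_upwards [hW0] with ω hω
    have hset : ∀ g, successIndicator c h η Ptx σ2 β B ((x, true, g), W ω) =
        (Set.Ici (β * uavDist c h x ^ η * (W ω + σ2 / Ptx))).indicator 1 g := fun g => by
      have hDη : uavDist c h x ^ (-η) = (uavDist c h x ^ η)⁻¹ := Real.rpow_neg hD.le η
      have hpos : 0 < uavDist c h x ^ η := by positivity
      have hiff : β * (W ω + σ2 / Ptx) ≤ g * uavDist c h x ^ (-η) ↔
          β * uavDist c h x ^ η * (W ω + σ2 / Ptx) ≤ g := by
        rw [hDη, ← div_eq_mul_inv, le_div_iff₀ hpos]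
        ring_nf
      simp [successIndicator, Set.indicator, hx, hiff]
    simp_rw [hset]
    rw [lintegral_indicator_one measurableSet_Ici, gammaMeasure_Ici hm hm0 (by positivity)]
    ring_nf
  rw [setLIntegral_congr_fun hB hinner,
    lintegral_lens_uavDist (f := fun r => ∫⁻ ω, ENNReal.ofReal (erlangTail m (m * β * r ^ η *
          (W ω + σ2 / Ptx))) ∂μ) c e hh hRmse hRmseR hedge
      (Measurable.lintegral_prod_right' (f := fun p : ℝ × Ω =>
        ENNReal.ofReal (erlangTail m (m * β * p.1 ^ η * (W p.2 + σ2 / Ptx)))) (by fun_prop))]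
  rw [← mul_assoc, ← mul_assoc]
  congr 2
  -- The area in the Poisson mean cancels the normalization of the uniform law.
  rw [ENNReal.coe_mul, ENNReal.coe_toNNReal hAfin, mul_assoc, ENNReal.mul_inv_cancel hV hAfin,
    mul_one]

end MeasurableNetwork

/-! ### From the SINR to received powers; uniqueness of the successful device. -/

section Slot

variable {Ω : Type*} (c e : Plane) (h R Rmse η Ptx σ2 β : ℝ)
  (N : Ω → ℕ) (X : ℕ → Ω → Plane) (T : ℕ → Ω → Bool) (G : ℕ → Ω → ℝ) (ω : Ω)

theorem mem_transmitters {n : ℕ} : n ∈ transmitters c R N X T ω ↔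
    n < N ω ∧ X n ω ∈ Metric.closedBall c R ∧ T n ω = true := by
  simp [transmitters]

/-- Assigning power `0` to inactive devices trades the random index set for a sum of one fixed
function of the i.i.d. marks, the form the Poisson lemmas require. -/
theorem interference_eq_sum_receivedPower : interference c h R η Ptx σ2 N X T G ω =
    ∑ j ∈ Finset.range (N ω), receivedPower c h R η (X j ω, T j ω, G j ω) + σ2 / Ptx := by
  rw [interference, transmitters, Finset.sum_filter]
  rfl

theorem sum_erase_transmitters (n : ℕ) :
    ∑ j ∈ (transmitters c R N X T ω).erase n, G j ω * uavDist c h (X j ω) ^ (-η) =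
      ∑ j ∈ (Finset.range (N ω)).erase n, receivedPower c h R η (X j ω, T j ω, G j ω) := by
  classical
  have : (transmitters c R N X T ω).erase n = ((Finset.range (N ω)).erase n).filter
      (fun j => X j ω ∈ Metric.closedBall c R ∧ T j ω = true) := by
    ext j
    simp only [Finset.mem_erase, mem_transmitters, Finset.mem_filter, Finset.mem_range, and_assoc]
  rw [this, Finset.sum_filter]
  refine Finset.sum_congr rfl fun j _ => ?_
  simp only [receivedPower]

variable {Ptx σ2 G ω}

/-- Nonnegative gains and positive noise make the denominator positive, so it can be cleared and the
common factor `Ptx` divided out. -/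
theorem le_sinr_iff (hPtx : 0 < Ptx) (hσ2 : 0 < σ2) (hG : ∀ n, 0 ≤ G n ω) (n : ℕ) :
    β ≤ sinr c h R η Ptx σ2 N X T G ω n ↔
      β * (∑ j ∈ (Finset.range (N ω)).erase n, receivedPower c h R η (X j ω, T j ω, G j ω) +
        σ2 / Ptx) ≤ G n ω * uavDist c h (X n ω) ^ (-η) := by
  have h0 : 0 ≤ ∑ j ∈ (Finset.range (N ω)).erase n,
      receivedPower c h R η (X j ω, T j ω, G j ω) :=
    Finset.sum_nonneg fun j _ => receivedPower_nonneg c h R η (hG j)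
  rw [sinr]
  simp_rw [mul_assoc Ptx]
  rw [← Finset.mul_sum, sum_erase_transmitters, le_div_iff₀ (by positivity),
    ← mul_le_mul_iff_right₀ hPtx]
  field_simp

variable {β}

/-- As `β ≥ 1`, at most one device is successful, so that the number of successes is an
indicator. -/
theorem sum_successIndicator_eq_indicator (hPtx : 0 < Ptx) (hσ2 : 0 < σ2) (hβ : 1 ≤ β)
    (hG : ∀ n, 0 ≤ G n ω) :
    ∑ n ∈ Finset.range (N ω), successIndicator c h η Ptx σ2 β
        (Metric.closedBall e Rmse ∩ Metric.closedBall c R) ((X n ω, T n ω, G n ω),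
          ∑ j ∈ (Finset.range (N ω)).erase n, receivedPower c h R η (X j ω, T j ω, G j ω)) =
      (successEvent c e h R Rmse η Ptx σ2 β N X T G).indicator 1 ω := by
  have hσ : 0 < σ2 / Ptx := by positivity
  have hrp : ∀ j, 0 ≤ receivedPower c h R η (X j ω, T j ω, G j ω) := fun j =>
    receivedPower_nonneg c h R η (hG j)
  by_cases hω : ω ∈ successEvent c e h R Rmse η Ptx σ2 β N X T G
  · rw [Set.indicator_of_mem hω]
    obtain ⟨n, hn, hX, hs⟩ := hω
    rw [mem_transmitters] at hn
    rw [le_sinr_iff c h R η β N X T hPtx hσ2 hG] at hs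
    rw [Finset.sum_eq_single_of_mem n (Finset.mem_range.2 hn.1), successIndicator,
      if_pos ⟨⟨hX, hn.2.2⟩, hs⟩, Pi.one_apply]
    intro k hk hkn
    rw [successIndicator, if_neg]
    rintro ⟨⟨hXk, hTk⟩, hsk⟩
    -- A successful `j` has power at least that of any other transmitter `i` plus the noise, as `β ≥
    -- 1`. Applied both ways to two successes, this contradicts positive noise.
    have key : ∀ i j, i ≠ j → i < N ω → X i ω ∈ Metric.closedBall c R → T i ω = true →
        β * (∑ l ∈ (Finset.range (N ω)).erase j, receivedPower c h R η (X l ω, T l ω, G l ω) +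
          σ2 / Ptx) ≤ G j ω * uavDist c h (X j ω) ^ (-η) →
        G i ω * uavDist c h (X i ω) ^ (-η) + σ2 / Ptx ≤ G j ω * uavDist c h (X j ω) ^ (-η) := by
      intro i j hij hi hXi hTi hle
      have h1 : receivedPower c h R η (X i ω, T i ω, G i ω) ≤ ∑ l ∈ (Finset.range (N ω)).erase j,
          receivedPower c h R η (X l ω, T l ω, G l ω) :=
        Finset.single_le_sum (f := fun l => receivedPower c h R η (X l ω, T l ω, G l ω))
          (fun l _ => hrp l) (Finset.mem_erase.2 ⟨hij, Finset.mem_range.2 hi⟩)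
      have h2 := hrp i
      rw [receivedPower, if_pos ⟨hXi, hTi⟩] at h1 h2
      refine le_trans ?_ hle
      nlinarith
    have h1 := key n k (Ne.symm hkn) hn.1 hn.2.1 hn.2.2 hsk
    have h2 := key k n hkn (Finset.mem_range.1 hk) hXk.2 hTk hs
    linarith
  · rw [Set.indicator_of_notMem hω]
    refine Finset.sum_eq_zero fun n hn => ?_
    rw [successIndicator, if_neg]
    rintro ⟨⟨hX, hT⟩, hs⟩
    exact hω ⟨n, (mem_transmitters c R N X T ω).2 ⟨Finset.mem_range.1 hn, hX.2, hT⟩, hX,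
      (le_sinr_iff c h R η β N X T hPtx hσ2 hG n).2 hs⟩

end Slot

/-! ### The success probability. -/

theorem corollary1 {Ω : Type*} [MeasurableSpace Ω] (μ : Measure Ω) [IsProbabilityMeasure μ]
    (A : Set Plane) (hA : MeasurableSet A) (hAfin : volume A ≠ ⊤)
    (lam : ℝ≥0) (a : unitInterval) (m : ℕ) (hm : 1 ≤ m)
    (N : Ω → ℕ) (X : ℕ → Ω → Plane) (T : ℕ → Ω → Bool) (G : ℕ → Ω → ℝ)
    (hnet : IsAlohaNetwork μ A lam a m N X T G)
    (c e : Plane) (h R Rmse η Ptx σ2 β : ℝ)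
    (hh : 0 < h) (hη : 0 < η) (hPtx : 0 < Ptx) (hσ2 : 0 < σ2) (hβ : 1 ≤ β)
    (hRmse : 0 < Rmse) (hRmseR : Rmse ≤ R)
    (hdisk : Metric.closedBall c R ⊆ A) (hedge : dist e c = R) :
    (∀ s : ℝ, 0 ≤ s →
      ∫ ω, Real.exp (-s * interference c h R η Ptx σ2 N X T G ω) ∂μ =
        laplaceI lam a h R η Ptx σ2 m s) ∧
    IntervalIntegrable (successIntegrand lam a h R Rmse η Ptx σ2 β m) volume
      (Real.sqrt (h ^ 2 + (R - Rmse) ^ 2)) (Real.sqrt (h ^ 2 + R ^ 2)) ∧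
    μ.real (successEvent c e h R Rmse η Ptx σ2 β N X T G) =
      2 * a * lam *
        ∫ r in Real.sqrt (h ^ 2 + (R - Rmse) ^ 2)..Real.sqrt (h ^ 2 + R ^ 2),
          successIntegrand lam a h R Rmse η Ptx σ2 β m r := by
  have hR : 0 < R := hRmse.trans_le hRmseR
  have hm0 : (0 : ℝ) < m := by exact_mod_cast hm
  have hβ0 : 0 < β := zero_lt_one.trans_le hβ
  -- `HasLaw` gives only a.e. measurability, so the argument runs on measurable versions and is
  -- transferred back almost everywhere.
  set Z : ℕ → Ω → Plane × Bool × ℝ := fun n => (hnet.law_node n).aemeasurable.mk _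
  set M : Ω → ℕ := hnet.law_count.aemeasurable.mk _
  have hZ : ∀ n, Measurable (Z n) := fun n => (hnet.law_node n).aemeasurable.measurable_mk
  have hM : Measurable M := hnet.law_count.aemeasurable.measurable_mk
  have hZe : ∀ n, (fun ω => (X n ω, T n ω, G n ω)) =ᵐ[μ] Z n := fun n =>
    (hnet.law_node n).aemeasurable.ae_eq_mk
  have hMe : N =ᵐ[μ] M := hnet.law_count.aemeasurable.ae_eq_mk
  have hZall : ∀ᵐ ω ∂μ, ∀ n, (X n ω, T n ω, G n ω) = Z n ω := ae_all_iff.2 hZe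
  have hlaw : ∀ n, μ.map (Z n) = nodeLaw A a m := fun n => by
    rw [← Measure.map_congr (hZe n)]
    exact (hnet.law_node n).map_eq
  have hind : iIndepFun Z μ := hnet.indep_nodes.congr hZe
  have hMlaw : μ.map M = poissonMeasure (lam * (volume A).toNNReal) := by
    rw [← Measure.map_congr hMe]
    exact hnet.law_count.map_eq
  have hMZ : IndepFun M (fun ω n => Z n ω) μ :=
    hnet.indep_count.congr hMe (hZall.mono fun ω hω => funext hω)
  have hG := ae_nonneg_gain hZ hlaw hm
  set I : Ω → ℝ := fun ω =>
    ∑ j ∈ Finset.range (M ω), receivedPower c h R η (Z j ω) + σ2 / Ptx with hI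
  have hIm : Measurable I := (measurable_sum_receivedPower hZ hM c h R η).add_const _
  have hI0 : ∀ᵐ ω ∂μ, 0 ≤ I ω := by
    filter_upwards [hG] with ω hω
    have := Finset.sum_nonneg fun j (_ : j ∈ Finset.range (M ω)) =>
      receivedPower_nonneg c h R η (hω j)
    positivity
  have hlap : ∀ s : ℝ, 0 ≤ s → ∫ ω, Real.exp (-s * I ω) ∂μ = laplaceI lam a h R η Ptx σ2 m s :=
    fun s hs => integral_exp_neg_sum_receivedPower hZ hlaw hind hM hMlaw hMZ hA hAfin hm hh hR hs
      hdisk hedge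
  set r₀ := Real.sqrt (h ^ 2 + (R - Rmse) ^ 2)
  set d := Real.sqrt (h ^ 2 + R ^ 2)
  have hr₀0 : 0 < r₀ := by positivity
  have hr₀d : r₀ ≤ d := Real.sqrt_le_sqrt (by nlinarith)
  set w : ℝ → ℝ := fun r =>
    Real.arccos ((R ^ 2 + r ^ 2 - h ^ 2 - Rmse ^ 2) / (2 * R * Real.sqrt (r ^ 2 - h ^ 2)))
  have hw : Measurable w := Real.continuous_arccos.measurable.comp (by fun_prop)
  set ψ : ℝ → ℝ≥0∞ := fun r => ∫⁻ ω, ENNReal.ofReal (erlangTail m (m * β * r ^ η * I ω)) ∂μ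
  have hψm : Measurable ψ := Measurable.lintegral_prod_right' (f := fun p : ℝ × Ω =>
    ENNReal.ofReal (erlangTail m (m * β * p.1 ^ η * I p.2))) (by fun_prop)
  have hψ1 : ∀ r, 0 < r → ψ r ≤ 1 := fun r hr => by
    calc ψ r ≤ ∫⁻ _, 1 ∂μ := by
          refine lintegral_mono_ae ?_
          filter_upwards [hI0] with ω hω
          rw [ENNReal.ofReal_le_one]
          exact erlangTail_le_one m (by positivity)
      _ = 1 := by simp
  have hint : ∀ r, 0 < r →
      successIntegrand lam a h R Rmse η Ptx σ2 β m r = (ψ r).toReal * r * w r := fun r hr => by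
    rw [successIntegrand, sum_iteratedDeriv_laplace hIm hI0 hlap m (by positivity),
      integral_eq_lintegral_of_nonneg_ae]
    · filter_upwards [hI0] with ω hω
      exact erlangTail_nonneg m (by positivity)
    · exact (by fun_prop : Measurable fun ω => erlangTail m (m * β * r ^ η * I ω)).aestronglyMeasurable
  -- Bounded on a bounded interval: a tail probability is at most `1`, `r` at most `d`, and `arccos`
  -- at most `π`.
  have hintOn : IntegrableOn (fun r => (ψ r).toReal * r * w r) (Set.Ioc r₀ d) := by
    refine Measure.integrableOn_of_bounded (M := 1 * d * Real.pi) (by simp)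
      (by fun_prop) ((ae_restrict_iff' measurableSet_Ioc).2 (Filter.Eventually.of_forall ?_))
    intro r hr
    have hr0 : 0 < r := hr₀0.trans hr.1
    have hψr : (ψ r).toReal ≤ 1 := ENNReal.toReal_le_of_le_ofReal zero_le_one (by simpa using hψ1 r hr0)
    have hw0 : 0 ≤ w r := Real.arccos_nonneg _
    have hwpi : w r ≤ Real.pi := Real.arccos_le_pi _
    rw [Real.norm_of_nonneg (by positivity)]
    exact mul_le_mul (mul_le_mul hψr hr.2 hr0.le zero_le_one) hwpi hw0 (by positivity)
  have hEq : Set.EqOn (successIntegrand lam a h R Rmse η Ptx σ2 β m)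
      (fun r => (ψ r).toReal * r * w r) (Set.Ioc r₀ d) := fun r hr => hint r (hr₀0.trans hr.1)
  refine ⟨fun s hs => ?_, ?_, ?_⟩
  · rw [← hlap s hs]
    refine integral_congr_ae ?_
    filter_upwards [hZall, hMe] with ω hω hN
    simp only [interference_eq_sum_receivedPower, hω, hN, hI]
  · rw [intervalIntegrable_iff_integrableOn_Ioc_of_le hr₀d]
    exact hintOn.congr_fun hEq.symm measurableSet_Ioc
  · have hΦ := lintegral_sum_successIndicator (η := η) hZ hlaw hind hM hMlaw hMZ hA hAfin hm hh hPtx hσ2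
      hβ0 hRmse hRmseR hdisk hedge
    set B := Metric.closedBall e Rmse ∩ Metric.closedBall c R
    have hB : MeasurableSet B := measurableSet_closedBall.inter measurableSet_closedBall
    set Φ : Ω → ℝ≥0∞ := fun ω => ∑ n ∈ Finset.range (M ω), successIndicator c h η Ptx σ2 β B
      (Z n ω, ∑ j ∈ (Finset.range (M ω)).erase n, receivedPower c h R η (Z j ω))
    have hΦm : Measurable Φ := measurable_apply_count (F := fun k v => ∑ n ∈ Finset.range k,
      successIndicator c h η Ptx σ2 β B
        (v n, ∑ j ∈ (Finset.range k).erase n, receivedPower c h R η (v j))) hZ hM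
      fun k => Finset.measurable_sum _ fun n _ =>
        (measurable_successIndicator c h η Ptx σ2 β hB).comp ((measurable_pi_apply n).prodMk
          (Finset.measurable_sum _ fun j _ =>
            (measurable_receivedPower c h R η).comp (measurable_pi_apply j)))
    set S := successEvent c e h R Rmse η Ptx σ2 β N X T G
    have hΦS : Φ =ᵐ[μ] S.indicator 1 := by
      filter_upwards [hZall, hMe, hG] with ω hω hN hGω
      have hG' : ∀ n, 0 ≤ G n ω := fun n => by
        have := hGω n
        rw [← hω n] at this
        exact this
      rw [← sum_successIndicator_eq_indicator c e h R Rmse η N X T hPtx hσ2 hβ hG', hN]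
      simp only [hω, Φ, B]
    -- The event is built from the original variables, so it is measurable only up to a null set; it
    -- agrees a.e. with the measurable set `Φ = 1`.
    have hSnull : NullMeasurableSet S μ := by
      refine (hΦm (measurableSet_singleton 1)).nullMeasurableSet.congr ?_
      filter_upwards [hΦS] with ω hω
      apply propext
      show Φ ω = 1 ↔ ω ∈ S
      rw [hω]
      by_cases h : ω ∈ S <;> simp [h]
    have hμS : μ S = ENNReal.ofReal (2 * a * lam * ∫ r in r₀..d,
        successIntegrand lam a h R Rmse η Ptx σ2 β m r) := by
      rw [← lintegral_indicator_one₀ hSnull, ← lintegral_congr_ae hΦS, hΦ,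
        intervalIntegral.integral_of_le hr₀d, setIntegral_congr_fun measurableSet_Ioc hEq,
        show 2 * (a : ℝ) * lam = lam * a * 2 by ring, mul_assoc ((lam : ℝ) * a),
        ← integral_const_mul, ENNReal.ofReal_mul (by have := a.2.1; positivity),
        ENNReal.ofReal_mul (by positivity), ENNReal.ofReal_coe_nnreal,
        ofReal_integral_eq_lintegral_ofReal (hintOn.const_mul 2)]
      · congr 1
        refine setLIntegral_congr_fun measurableSet_Ioc fun r hr => ?_
        have hr0 : 0 < r := hr₀0.trans hr.1
        have hw0 : 0 ≤ w r := Real.arccos_nonneg _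
        show ENNReal.ofReal (2 * r * w r) * ψ r = ENNReal.ofReal (2 * ((ψ r).toReal * r * w r))
        rw [show 2 * ((ψ r).toReal * r * w r) = 2 * r * w r * (ψ r).toReal by ring,
          ENNReal.ofReal_mul (p := 2 * r * w r) (by positivity),
          ENNReal.ofReal_toReal ((hψ1 r hr0).trans_lt ENNReal.one_lt_top).ne]
      · refine (ae_restrict_iff' measurableSet_Ioc).2 (Filter.Eventually.of_forall fun r hr => ?_)
        have hr0 : 0 < r := hr₀0.trans hr.1
        have hw0 : 0 ≤ w r := Real.arccos_nonneg _
        show 0 ≤ 2 * ((ψ r).toReal * r * w r)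
        positivity
    rw [measureReal_def, hμS, ENNReal.toReal_ofReal]
    refine mul_nonneg (by have := a.2.1; positivity) ?_
    rw [intervalIntegral.integral_of_le hr₀d]
    refine setIntegral_nonneg measurableSet_Ioc fun r hr => ?_
    have hr0 : 0 < r := hr₀0.trans hr.1
    have hw0 : 0 ≤ w r := Real.arccos_nonneg _
    rw [hEq hr]
    positivity
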